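/- An \emph{ordinal graph} is a small category $\Lambda$ (identified with its set of morphisms, called paths; identities are called vertices; $s(e)$ and $r(e)$ are the source and range of $e$, and $ef$ is defined when $s(e)=r(f)$) with a functor $d:\Lambda\to\mathrm{Ord}$, i.e. $d(ef)=d(e)+d(f)$ and $d$ is $0$ on vertices, such that for all $e\in\Lambda$ and ordinals $\alpha\le d(e)$ there are unique $f,g\in\Lambda$ with $e=fg$ and $d(f)=\alpha$; write $f=e(\alpha)$. For a vertex $v$ put $v\Lambda^{\omega^\alpha}=\{e\in\Lambda: r(e)=v,\ d(e)=\omega^\alpha\}$. The vertex $v$ is \emph{$\alpha$-regular} if $v\Lambda^{\omega^\alpha}$ is finite and for every $e\in\Lambda$ with $r(e)=v$ and $d(e)<\omega^\alpha$ the set $s(e)\Lambda^{\omega^\alpha}$ is non-empty. Let $\mathcal O(\Lambda)$ be the universal $C^*$-algebra generated by elements $T_e$, $e\in\Lambda$, subject to (1) $T_e^*T_e=T_{s(e)}$; (2) $T_eT_f=T_{ef}$ if $s(e)=r(f)$; (3) $T_e^*T_f=0$ if $e\Lambda\cap f\Lambda=\emptyset$; (4) $T_v=\sum_{e\in v\Lambda^{\omega^\alpha}}T_eT_e^*$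 if the vertex $v$ is $\alpha$-regular. Let $\Lambda^*$ be the set of all families $f=(f(\beta))_{\beta<L(f)}$, where $L(f)>0$ is an ordinal, with $f(\beta)\in\Lambda$, $d(f(\beta))=\beta$, and $f(\beta)\in f(\gamma)\Lambda$ for $\gamma\le\beta<L(f)$; let $r(f)=f(0)$. For $e\in\Lambda$ and $f\in\Lambda^*$ with $s(e)=r(f)$ let $ef\in\Lambda^*$ be given by $L(ef)=d(e)+L(f)$, $(ef)(\beta)=e\,f(-d(e)+\beta)$ for $d(e)\le\beta<L(ef)$ and $(ef)(\beta)=e(\beta)$ for $\beta<d(e)$. The set $\partial\Lambda$ of \emph{boundary paths} consists of those $f\in\Lambda^*$ such that for all $\gamma<L(f)$ and all ordinals $\alpha$, if $s(f(\gamma))$ is $\alpha$-regular, then $L(f)>\gamma+\omega^\alpha$. Let $(\xi_f)_{f\in\partial\Lambda}$ be the standard orthonormal basis of $\ell^2(\partial\Lambda)$. \textbf{Proposition.} For every ordinal graph $\Lambda$ there is a representation ($*$-homomorphism) $\tau:\mathcal O(\Lambda)\to B(\ell^2(\partial\Lambda))$ such that for all $e\in\Lambda$ and $f\in\partial\Lambda$: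 if $s(e)=r(f)$, then $ef\in\partial\Lambda$ and $\tau(T_e)\xi_f=\xi_{ef}$; if $s(e)\ne r(f)$, then $\tau(T_e)\xi_f=0$. -/

import Mathlib

open UniformSpace CategoryTheory

universe w v u

/-- A complex `*`-algebra with a `C*`-seminorm. -/
class PreCStarAlgebra (A : Type*) extends NonUnitalSeminormedRing A, StarRing A,
    NormedSpace ℂ A, IsScalarTower ℂ A A, SMulCommClass ℂ A A, StarModule ℂ A where
  norm_star_mul_self : ∀ a : A, ‖star a * a‖ = ‖a‖ * ‖a‖

namespace PreCStarAlgebra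

variable {A : Type*} [PreCStarAlgebra A]

theorem norm_le_norm_star (a : A) : ‖a‖ ≤ ‖star a‖ := by
  rcases (norm_nonneg a).eq_or_lt with h | h
  · rw [← h]; exact norm_nonneg _
  · refine le_of_mul_le_mul_right ?_ h
    rw [← norm_star_mul_self a]
    exact norm_mul_le _ _

instance : NormedStarGroup A where
  norm_star_le a := by simpa using norm_le_norm_star (star a)

/-! The completion of a `*`-algebra with a `C*`-seminorm is a `C*`-algebra. -/

noncomputable instance : Mul (Completion A) :=
  ⟨Function.curry <| (Completion.isDenseInducing_coe.prodMap Completion.isDenseInducing_coe).extend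
    ((↑) ∘ Function.uncurry (· * ·))⟩

theorem coe_mul (a b : A) : ((a * b : A) : Completion A) = a * b :=
  ((Completion.isDenseInducing_coe.prodMap Completion.isDenseInducing_coe).extend_eq
    ((Completion.continuous_coe A).comp (@continuous_mul A _ _ _)) (a, b)).symm

instance : ContinuousMul (Completion A) where
  continuous_mul := by
    let m := (AddMonoidHom.mul : A →+ A →+ A).compr₂ Completion.toCompl
    have : Continuous fun p : A × A => m p.1 p.2 :=
      (Completion.continuous_coe A).comp continuous_mul
    have di : IsDenseInducing (Completion.toCompl : A → Completion A) :=
      Completion.isDenseInducing_coe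
    exact (di.extend_Z_bilin di this :)

noncomputable instance : NonUnitalNormedRing (Completion A) where
  __ := (inferInstance : NormedAddCommGroup (Completion A))
  __ := (inferInstance : Mul (Completion A))
  zero_mul a := by
    induction a using Completion.induction_on with
    | hp => exact isClosed_eq (by fun_prop) continuous_const
    | ih a => rw [← Completion.coe_zero, ← coe_mul, zero_mul]
  mul_zero a := by
    induction a using Completion.induction_on with
    | hp => exact isClosed_eq (by fun_prop) continuous_const
    | ih a => rw [← Completion.coe_zero, ← coe_mul, mul_zero]
  mul_assoc a b c := by
    induction a, b, c using Completion.induction_on₃ with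
    | hp => exact isClosed_eq (by fun_prop) (by fun_prop)
    | ih a b c => rw [← coe_mul, ← coe_mul, ← coe_mul, ← coe_mul, mul_assoc]
  left_distrib a b c := by
    induction a, b, c using Completion.induction_on₃ with
    | hp => exact isClosed_eq (by fun_prop) (by fun_prop)
    | ih a b c =>
      rw [← Completion.coe_add, ← coe_mul, ← coe_mul, ← coe_mul, ← Completion.coe_add, mul_add]
  right_distrib a b c := by
    induction a, b, c using Completion.induction_on₃ with
    | hp => exact isClosed_eq (by fun_prop) (by fun_prop)
    | ih a b c =>
      rw [← Completion.coe_add, ← coe_mul, ← coe_mul, ← coe_mul, ← Completion.coe_add, add_mul]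
  norm_mul_le a b := by
    induction a, b using Completion.induction_on₂ with
    | hp => apply isClosed_le <;> fun_prop
    | ih a b => simpa only [← coe_mul, Completion.norm_coe] using norm_mul_le a b

noncomputable instance : Star (Completion A) := ⟨Completion.map star⟩

theorem uniformContinuous_star : UniformContinuous (star : A → A) :=
  (LipschitzWith.mk_one fun a b => by
    rw [dist_eq_norm, dist_eq_norm, ← star_sub, norm_star]).uniformContinuous

theorem coe_star (a : A) : ((star a : A) : Completion A) = star (a : Completion A) :=
  (Completion.map_coe uniformContinuous_star a).symm

instance : ContinuousStar (Completion A) := ⟨Completion.continuous_map⟩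

noncomputable instance : StarRing (Completion A) where
  star_involutive a := by
    induction a using Completion.induction_on with
    | hp => exact isClosed_eq (by fun_prop) continuous_id
    | ih a => rw [← coe_star, ← coe_star, star_star]
  star_mul a b := by
    induction a, b using Completion.induction_on₂ with
    | hp => exact isClosed_eq (by fun_prop) (by fun_prop)
    | ih a b => rw [← coe_mul, ← coe_star, ← coe_star, ← coe_star, ← coe_mul, star_mul]
  star_add a b := by
    induction a, b using Completion.induction_on₂ with
    | hp => exact isClosed_eq (by fun_prop) (by fun_prop)
    | ih a b =>
      rw [← Completion.coe_add, ← coe_star, ← coe_star, ← coe_star, ← Completion.coe_add, star_add]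

theorem smul_mul (c : ℂ) (a b : Completion A) : (c • a) * b = c • (a * b) := by
  induction a, b using Completion.induction_on₂ with
  | hp =>
    exact isClosed_eq (((continuous_const_smul c).comp continuous_fst).mul continuous_snd)
      ((continuous_const_smul c).comp (continuous_fst.mul continuous_snd))
  | ih a b =>
    rw [← Completion.coe_smul, ← coe_mul, ← coe_mul, ← Completion.coe_smul, smul_mul_assoc]

theorem mul_smul' (c : ℂ) (a b : Completion A) : a * (c • b) = c • (a * b) := by
  induction a, b using Completion.induction_on₂ with
  | hp =>
    exact isClosed_eq (continuous_fst.mul ((continuous_const_smul c).comp continuous_snd))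
      ((continuous_const_smul c).comp (continuous_fst.mul continuous_snd))
  | ih a b =>
    rw [← Completion.coe_smul, ← coe_mul, ← coe_mul, ← Completion.coe_smul, mul_smul_comm]

theorem star_smul' (c : ℂ) (a : Completion A) : star (c • a) = star c • star a := by
  induction a using Completion.induction_on with
  | hp =>
    exact isClosed_eq (continuous_star.comp (continuous_const_smul c))
      ((continuous_const_smul (star c)).comp continuous_star)
  | ih a => rw [← Completion.coe_smul, ← coe_star, ← coe_star, ← Completion.coe_smul, star_smul]

theorem norm_mul_self_le' (a : Completion A) : ‖a‖ * ‖a‖ ≤ ‖star a * a‖ := by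
  induction a using Completion.induction_on with
  | hp => exact isClosed_le (by fun_prop) (by fun_prop)
  | ih a =>
    rw [← coe_star, ← coe_mul, Completion.norm_coe, Completion.norm_coe, norm_star_mul_self]

noncomputable instance : NonUnitalCStarAlgebra (Completion A) where
  __ := (inferInstance : NonUnitalNormedRing (Completion A))
  __ := (inferInstance : StarRing (Completion A))
  __ := (inferInstance : CompleteSpace (Completion A))
  __ := (inferInstance : NormedSpace ℂ (Completion A))
  norm_mul_self_le := norm_mul_self_le'
  smul_assoc c a b := smul_mul c a b
  smul_comm c a b := (mul_smul' c a b).symm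
  star_smul := star_smul'

end PreCStarAlgebra

/-! ### The free `*`-algebra -/

/-- The free nonunital complex `*`-algebra on `X`: linear combinations of nonempty words in the
letters `x = (x, false)` and `x* = (x, true)`. -/
abbrev FreeStarAlgebra (X : Type*) := MonoidAlgebra ℂ (FreeSemigroup (X × Bool))

namespace FreeStarAlgebra

variable {X : Type*}

/-- The involution on words: reverse the word and exchange `x` and `x*`. -/
def wordStar (w : FreeSemigroup (X × Bool)) : FreeSemigroup (X × Bool) :=
  (FreeSemigroup.lift (fun p : X × Bool => MulOpposite.op (FreeSemigroup.of (p.1, !p.2))) w).unop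

theorem wordStar_of (p : X × Bool) :
    wordStar (FreeSemigroup.of p) = FreeSemigroup.of (p.1, !p.2) := by
  simp [wordStar]

theorem wordStar_mul (v w : FreeSemigroup (X × Bool)) :
    wordStar (v * w) = wordStar w * wordStar v := by
  simp [wordStar]

theorem wordStar_wordStar (w : FreeSemigroup (X × Bool)) : wordStar (wordStar w) = w := by
  induction w using FreeSemigroup.recOnMul with
  | ih1 p => simp [wordStar_of]
  | ih2 p w h1 h2 => rw [wordStar_mul, wordStar_mul, h1, h2]

/-- The conjugate linear extension of `wordStar`. -/
noncomputable def starHom : FreeStarAlgebra X →+ FreeStarAlgebra X where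
  toFun a := a.coeff.sum fun w c => MonoidAlgebra.single (wordStar w) (star c)
  map_zero' := by simp
  map_add' a b := by
    simp only [MonoidAlgebra.coeff_add]
    exact Finsupp.sum_add_index' (by simp) (by simp)

theorem starHom_single (w : FreeSemigroup (X × Bool)) (c : ℂ) :
    starHom (MonoidAlgebra.single w c) = MonoidAlgebra.single (wordStar w) (star c) := by
  simp [starHom]

noncomputable instance : StarRing (FreeStarAlgebra X) where
  star := starHom
  star_involutive a := by
    induction a using MonoidAlgebra.induction_linear with
    | zero => simp
    | add a b ha hb => simp [ha, hb]
    | single w c => simp [starHom_single, wordStar_wordStar]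
  star_mul a b := by
    change starHom (a * b) = starHom b * starHom a
    induction a using MonoidAlgebra.induction_linear with
    | zero => simp
    | add a a' ha ha' => simp [add_mul, mul_add, ha, ha']
    | single w c =>
      induction b using MonoidAlgebra.induction_linear with
      | zero => simp
      | add b b' hb hb' => simp [add_mul, mul_add, hb, hb']
      | single v d =>
        simp [starHom_single, MonoidAlgebra.single_mul_single, wordStar_mul, mul_comm]
  star_add a b := map_add starHom a b

instance : StarModule ℂ (FreeStarAlgebra X) where
  star_smul c a := by
    change starHom (c • a) = star c • starHom a
    induction a using MonoidAlgebra.induction_linear with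
    | zero => simp
    | add a b ha hb => simp [ha, hb]
    | single w d => simp [starHom_single]

/-- The generator `x` of the free `*`-algebra. -/
noncomputable def of (x : X) : FreeStarAlgebra X := MonoidAlgebra.single (FreeSemigroup.of (x, false)) 1

end FreeStarAlgebra

/-- The morphisms ("paths") of a small category, collected in one type. A path with source `src`
and range `rng` is a morphism `src ⟶ rng`. -/
structure Mor (V : Type u) [Category.{v} V] where
  {src rng : V}
  hom : src ⟶ rng

namespace Mor

variable {V : Type u} [Category.{v} V]

/-- The vertex `x`, i.e. the identity morphism at `x`. -/
def vertex (x : V) : Mor V := ⟨𝟙 x⟩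

/-- The composite `e f` ("first `f`, then `e`") of paths with `s(e) = r(f)`. -/
def comp (e f : Mor V) (h : e.src = f.rng) : Mor V := ⟨f.hom ≫ eqToHom h.symm ≫ e.hom⟩

theorem comp_assoc (e f g : Mor V) (h : e.src = f.rng) (h' : f.src = g.rng) :
    (e.comp f h).comp g h' = e.comp (f.comp g h') h := by
  obtain ⟨e⟩ := e
  obtain ⟨f⟩ := f
  obtain ⟨g⟩ := g
  dsimp only at h h'
  subst h h'
  change (⟨g ≫ eqToHom rfl ≫ f ≫ eqToHom rfl ≫ e⟩ : Mor V) =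
    ⟨(g ≫ eqToHom rfl ≫ f) ≫ eqToHom rfl ≫ e⟩
  simp only [eqToHom_refl, Category.id_comp, Category.assoc]

/-- `p.IsPrefix q` means `q ∈ p Λ`. -/
def IsPrefix (p q : Mor V) : Prop := ∃ (g : Mor V) (h : p.src = g.rng), q = p.comp g h

theorem IsPrefix.rng_eq {p q : Mor V} (h : p.IsPrefix q) : q.rng = p.rng := by
  obtain ⟨g, h, rfl⟩ := h
  rfl

theorem isPrefix_comp (e f : Mor V) (h : e.src = f.rng) : e.IsPrefix (e.comp f h) := ⟨f, h, rfl⟩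

theorem IsPrefix.trans {p q t : Mor V} (h : p.IsPrefix q) (h' : q.IsPrefix t) : p.IsPrefix t := by
  obtain ⟨g, hg, rfl⟩ := h
  obtain ⟨k, hk, rfl⟩ := h'
  exact ⟨g.comp k hk, hg, Mor.comp_assoc ..⟩

end Mor

/-- An ordinal graph: a small category together with a functor `d` into the ordinals (the
one-object category with composition the addition of ordinals) that has the unique factorization
property: for `α ≤ d e` there are unique `f`, `g` with `e = f g` and `d f = α`. Recall that the
composite `f g` is `g ≫ f`. -/
structure OrdinalGraph (V : Type u) [Category.{v} V] where
  d : ∀ {x y : V}, (x ⟶ y) → Ordinal.{w}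
  d_id : ∀ x : V, d (𝟙 x) = 0
  d_comp : ∀ {x y z : V} (f : y ⟶ z) (g : x ⟶ y), d (g ≫ f) = d f + d g
  factorization : ∀ {x y : V} (e : x ⟶ y) (α : Ordinal.{w}), α ≤ d e →
    ∃! p : Σ z : V, (z ⟶ y) × (x ⟶ z), d p.2.1 = α ∧ e = p.2.2 ≫ p.2.1

namespace OrdinalGraph

variable {V : Type u} [Category.{v} V] (Λ : OrdinalGraph.{w} V)

/-- The length `d(e)` of a path. -/
def length (e : Mor V) : Ordinal.{w} := Λ.d e.hom

theorem length_comp (e f : Mor V) (h : e.src = f.rng) :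
    Λ.length (e.comp f h) = Λ.length e + Λ.length f := by
  obtain ⟨e⟩ := e
  obtain ⟨f⟩ := f
  dsimp only at h
  subst h
  simp [Mor.comp, length, Λ.d_comp]

theorem exists_isPrefix (e : Mor V) (α : Ordinal.{w}) (h : α ≤ Λ.length e) :
    ∃ p : Mor V, p.IsPrefix e ∧ Λ.length p = α := by
  obtain ⟨⟨z, f, g⟩, ⟨hf, he⟩, -⟩ := Λ.factorization e.hom α h
  refine ⟨⟨f⟩, ⟨⟨g⟩, rfl, ?_⟩, hf⟩
  obtain ⟨e⟩ := e
  simp only [Mor.comp, eqToHom_refl, Category.id_comp]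
  rw [← he]

theorem isPrefix_unique {e p q : Mor V} (hp : p.IsPrefix e) (hq : q.IsPrefix e)
    (h : Λ.length p = Λ.length q) : p = q := by
  obtain ⟨g, hg, rfl⟩ := hp
  obtain ⟨k, hk, hq⟩ := hq
  obtain ⟨p⟩ := p
  obtain ⟨q⟩ := q
  obtain ⟨g⟩ := g
  obtain ⟨k⟩ := k
  dsimp only at hg hk
  subst hg hk
  simp only [Mor.comp, eqToHom_refl, Category.id_comp, Mor.mk.injEq] at hq
  obtain ⟨rfl, rfl, hq⟩ := hq
  have hq := eq_of_heq hq
  have := (Λ.factorization (g ≫ p) (Λ.d p) (by rw [Λ.d_comp]; exact le_self_add)).unique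
    (y₁ := ⟨_, p, g⟩) (y₂ := ⟨_, q, k⟩) ⟨rfl, rfl⟩ ⟨h.symm, hq⟩
  simp only [Sigma.mk.injEq] at this
  obtain ⟨rfl, this⟩ := this
  have := eq_of_heq this
  simp only [Prod.mk.injEq] at this
  rw [this.1]

/-- The initial segment `e(α)` of length `α ≤ d(e)` of a path `e`. -/
noncomputable def initial (e : Mor V) (α : Ordinal.{w}) (h : α ≤ Λ.length e) : Mor V :=
  (Λ.exists_isPrefix e α h).choose

theorem initial_isPrefix (e : Mor V) (α : Ordinal.{w}) (h : α ≤ Λ.length e) :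
    (Λ.initial e α h).IsPrefix e :=
  (Λ.exists_isPrefix e α h).choose_spec.1

theorem length_initial (e : Mor V) (α : Ordinal.{w}) (h : α ≤ Λ.length e) :
    Λ.length (Λ.initial e α h) = α :=
  (Λ.exists_isPrefix e α h).choose_spec.2

/-! ### Regular vertices -/

/-- `v` is `α`-source-regular: for every `e ∈ v Λ` with `d(e) < ω ^ α` there is a path of length
`ω ^ α` with range `s(e)`. -/
def IsSourceRegular (x : V) (α : Ordinal.{w}) : Prop :=
  ∀ e : Mor V, e.rng = x → Λ.length e < Ordinal.omega0 ^ α →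
    ∃ f : Mor V, f.rng = e.src ∧ Λ.length f = Ordinal.omega0 ^ α

/-- The set `x Λ^{ω^α}` of the paths of length `ω ^ α` with range `x`. -/
def pathsInto (x : V) (α : Ordinal.{w}) : Set (Mor V) :=
  {f | f.rng = x ∧ Λ.length f = Ordinal.omega0 ^ α}

/-- `x` is `α`-row-finite. -/
def IsRowFinite (x : V) (α : Ordinal.{w}) : Prop := (Λ.pathsInto x α).Finite

/-- `x` is `α`-regular. -/
structure IsRegular (x : V) (α : Ordinal.{w}) : Prop where
  sourceRegular : Λ.IsSourceRegular x α
  rowFinite : Λ.IsRowFinite x α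

/-! ### Transfinite paths and boundary paths -/

/-- The elements of `Λ^*`: families `(f(β))_{β < L}`, for some ordinal `L > 0`, of paths with
`d(f(β)) = β` and `f(β) ∈ f(γ) Λ` for all `γ ≤ β < L`. -/
structure TransfinitePath where
  L : Ordinal.{w}
  L_pos : 0 < L
  seg : ∀ β : Ordinal.{w}, β < L → Mor V
  length_seg : ∀ (β : Ordinal.{w}) (h : β < L), Λ.length (seg β h) = β
  isPrefix_seg : ∀ (γ β : Ordinal.{w}) (hγβ : γ ≤ β) (h : β < L),
    (seg γ (hγβ.trans_lt h)).IsPrefix (seg β h)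

variable {Λ}

/-- The range `r(f)` of `f ∈ Λ^*`, i.e. the vertex `f(0)`. -/
def TransfinitePath.rng (f : Λ.TransfinitePath) : V := (f.seg 0 f.L_pos).rng

theorem TransfinitePath.rng_seg (f : Λ.TransfinitePath) (β : Ordinal.{w}) (h : β < f.L) :
    (f.seg β h).rng = f.rng :=
  (f.isPrefix_seg 0 β (zero_le (a := β)) h).rng_eq

variable (Λ)

open Classical in
/-- The concatenation `e f ∈ Λ^*` of `e ∈ Λ` and `f ∈ Λ^*` with `s(e) = r(f)`: it has
`L(e f) = d(e) + L(f)`, `(e f)(β) = e f(-d(e) + β)` for `β ≥ d(e)`, and `(e f)(β) = e(β)` for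
`β < d(e)`. The left difference `-d(e) + β` is Mathlib's `β - d(e)`. -/
noncomputable def concat (e : Mor V) (f : Λ.TransfinitePath) (h : e.src = f.rng) :
    Λ.TransfinitePath where
  L := Λ.length e + f.L
  L_pos := f.L_pos.trans_le le_add_self
  seg β hβ :=
    if hd : Λ.length e ≤ β then
      e.comp (f.seg (β - Λ.length e) ((Ordinal.sub_lt_of_le hd).2 hβ)) (h.trans (f.rng_seg _ _).symm)
    else Λ.initial e β (not_le.1 hd).le
  length_seg β hβ := by
    split_ifs with hd
    · rw [length_comp, f.length_seg, Ordinal.add_sub_cancel_of_le hd]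
    · exact Λ.length_initial _ _ _
  isPrefix_seg γ β hγβ hβ := by
    by_cases hγ : Λ.length e ≤ γ
    · have hd : Λ.length e ≤ β := hγ.trans hγβ
      simp only [hγ, hd, dite_true]
      obtain ⟨g, hg, hs⟩ := f.isPrefix_seg (γ - Λ.length e) (β - Λ.length e)
        (Ordinal.sub_le.2 (by rwa [Ordinal.add_sub_cancel_of_le hd]))
        ((Ordinal.sub_lt_of_le hd).2 hβ)
      refine ⟨g, hg, ?_⟩
      rw [Mor.comp_assoc]
      simp only [hs]
    · by_cases hd : Λ.length e ≤ β
      · simp only [hγ, hd, dite_true, dite_false]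
        exact (Λ.initial_isPrefix e γ _).trans (e.isPrefix_comp _ _)
      · simp only [hγ, hd, dite_false]
        obtain ⟨p, hp, hl⟩ := Λ.exists_isPrefix (Λ.initial e β (not_le.1 hd).le) γ
          (by rwa [length_initial])
        rwa [← Λ.isPrefix_unique (hp.trans (Λ.initial_isPrefix e β _))
          (Λ.initial_isPrefix e γ (not_le.1 hγ).le) (by rw [hl, length_initial])]

/-- `f ∈ Λ^*` is a boundary path. -/
def IsBoundary (f : Λ.TransfinitePath) : Prop :=
  ∀ (γ : Ordinal.{w}) (h : γ < f.L) (α : Ordinal.{w}),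
    Λ.IsRegular (f.seg γ h).src α → γ + Ordinal.omega0 ^ α < f.L

/-- The set `∂Λ` of boundary paths. -/
def BoundaryPath := {f : Λ.TransfinitePath // Λ.IsBoundary f}
end OrdinalGraph

namespace OrdinalGraph

variable {V : Type u} [Category.{v} V] (Λ : OrdinalGraph.{w} V)

/-! ### The `C*`-algebra of an ordinal graph -/

/-- The relations that define the `C*`-algebra of `Λ`, for a family `(S e)` indexed by all paths
`e ∈ Λ`. They are stated up to a relation `E` on `B`; `E` is equality for families in a
`C*`-algebra, and `p (a - b) = 0` for a seminorm `p` on the free `*`-algebra. The set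
`x Λ^{ω^α}` in the last relation is finite because `x` is `α`-regular. -/
structure Relations {B : Type*} [NonUnitalRing B] [StarRing B] (E : B → B → Prop)
    (S : Mor V → B) : Prop where
  star_mul_self : ∀ e : Mor V, E (star (S e) * S e) (S (Mor.vertex e.src))
  mul_eq_comp : ∀ (e f : Mor V) (h : e.src = f.rng), E (S e * S f) (S (e.comp f h))
  star_mul_eq_zero : ∀ e f : Mor V, (¬ ∃ g, e.IsPrefix g ∧ f.IsPrefix g) → E (star (S e) * S f) 0
  eq_sum : ∀ (x : V) (α : Ordinal.{w}) (h : Λ.IsRegular x α),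
    E (S (Mor.vertex x)) (∑ e ∈ h.rowFinite.toFinset, S e * star (S e))

/-- A Cuntz-Krieger family for `Λ`, indexed by all paths `e ∈ Λ`: it satisfies
* `S_e^* S_e = S_{s(e)}`,
* `S_e S_f = S_{ef}` if `s(e) = r(f)`,
* `S_e^* S_f = 0` if `eΛ ∩ fΛ = ∅`,
* `S_x = ∑ S_e S_e^*`, over the paths `e ∈ x Λ^{ω^α}`, if the vertex `x` is `α`-regular.

By the second relation such a family is determined by its members at the vertices and at the paths
whose length is a power of `ω`, since every path is a finite product of these. -/
def IsCuntzKrieger {B : Type*} [NonUnitalRing B] [StarRing B] (S : Mor V → B) : Prop :=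
  Λ.Relations (· = ·) S

/-- The `C*`-seminorms on the free `*`-algebra on the paths of `Λ` in which the defining relations
of the `C*`-algebra of `Λ` hold. -/
structure CStarSeminorm extends Seminorm ℂ (FreeStarAlgebra (Mor V)) where
  mul_le : ∀ a b, toSeminorm (a * b) ≤ toSeminorm a * toSeminorm b
  star_mul_self : ∀ a, toSeminorm (star a * a) = toSeminorm a * toSeminorm a
  relations : Λ.Relations (fun a b => toSeminorm (a - b) = 0) FreeStarAlgebra.of

variable {Λ}

namespace CStarSeminorm

variable (p : Λ.CStarSeminorm)

theorem eq_of_sub {a b : FreeStarAlgebra (Mor V)} (h : p.toSeminorm (a - b) = 0) :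
    p.toSeminorm a = p.toSeminorm b := by
  apply le_antisymm
  · simpa [h] using map_add_le_add p.toSeminorm (a - b) b
  · have := map_add_le_add p.toSeminorm (b - a) a
    rwa [map_sub_rev, h, zero_add, sub_add_cancel] at this

theorem le_star (a : FreeStarAlgebra (Mor V)) : p.toSeminorm a ≤ p.toSeminorm (star a) := by
  rcases (apply_nonneg p.toSeminorm a).eq_or_lt with h | h
  · rw [← h]; exact apply_nonneg _ _
  · refine le_of_mul_le_mul_right ?_ h
    rw [← p.star_mul_self a]
    exact p.mul_le _ _

theorem of_le_one (e : Mor V) : p.toSeminorm (FreeStarAlgebra.of e) ≤ 1 := by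
  have key : ∀ f : Mor V, p.toSeminorm (FreeStarAlgebra.of f) * p.toSeminorm (FreeStarAlgebra.of f)
      = p.toSeminorm (FreeStarAlgebra.of (Mor.vertex f.src)) := fun f => by
    rw [← p.star_mul_self]; exact p.eq_of_sub (p.relations.star_mul_self f)
  have h1 := key (Mor.vertex e.src)
  have h2 := key e
  change _ = p.toSeminorm (FreeStarAlgebra.of (Mor.vertex e.src)) at h1
  have := apply_nonneg p.toSeminorm (FreeStarAlgebra.of e)
  have := apply_nonneg p.toSeminorm (FreeStarAlgebra.of (Mor.vertex e.src))
  have h3 : p.toSeminorm (FreeStarAlgebra.of (Mor.vertex e.src)) ≤ 1 := by nlinarith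
  nlinarith

theorem letter_le_one (x : Mor V × Bool) :
    p.toSeminorm (MonoidAlgebra.single (FreeSemigroup.of x) 1) ≤ 1 := by
  obtain ⟨e, _ | _⟩ := x
  · exact p.of_le_one e
  · refine (p.le_star _).trans ?_
    change p.toSeminorm (FreeStarAlgebra.starHom _) ≤ 1
    rw [FreeStarAlgebra.starHom_single, FreeStarAlgebra.wordStar_of, star_one]
    exact p.of_le_one e

theorem word_le_one (x : FreeSemigroup (Mor V × Bool)) :
    p.toSeminorm (MonoidAlgebra.single x 1) ≤ 1 := by
  induction x using FreeSemigroup.recOnMul with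
  | ih1 x => exact p.letter_le_one x
  | ih2 x y hx hy =>
    have := p.mul_le (MonoidAlgebra.single (FreeSemigroup.of x) 1) (MonoidAlgebra.single y 1)
    rw [MonoidAlgebra.single_mul_single, mul_one] at this
    exact this.trans (mul_le_one₀ hx (apply_nonneg _ _) hy)

theorem bddAbove (a : FreeStarAlgebra (Mor V)) :
    BddAbove (Set.range fun p : Λ.CStarSeminorm => p.toSeminorm a) := by
  induction a using MonoidAlgebra.induction_linear with
  | zero => exact ⟨0, by rintro _ ⟨p, rfl⟩; simp⟩
  | add a b ha hb =>
    obtain ⟨M, hM⟩ := ha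
    obtain ⟨N, hN⟩ := hb
    refine ⟨M + N, ?_⟩
    rintro _ ⟨p, rfl⟩
    exact (map_add_le_add p.toSeminorm a b).trans (add_le_add (hM ⟨p, rfl⟩) (hN ⟨p, rfl⟩))
  | single x c =>
    refine ⟨‖c‖, ?_⟩
    rintro _ ⟨p, rfl⟩
    have : MonoidAlgebra.single x c = c • MonoidAlgebra.single x (1 : ℂ) := by simp
    change p.toSeminorm _ ≤ _
    rw [this, map_smul_eq_mul]
    exact mul_le_of_le_one_right (norm_nonneg c) (p.word_le_one x)

instance : Nonempty Λ.CStarSeminorm :=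
  ⟨{ toSeminorm := 0
     mul_le := by simp
     star_mul_self := by simp
     relations := ⟨by simp, by simp, by simp, by simp⟩ }⟩

end CStarSeminorm

variable (Λ)

/-- The largest `C*`-seminorm on the free `*`-algebra in which the defining relations hold. -/
noncomputable def maxSeminorm : Seminorm ℂ (FreeStarAlgebra (Mor V)) :=
  Seminorm.of (fun a => ⨆ p : Λ.CStarSeminorm, p.toSeminorm a)
    (fun a b => ciSup_le fun p => (map_add_le_add p.toSeminorm a b).trans
      (add_le_add (le_ciSup (CStarSeminorm.bddAbove a) p) (le_ciSup (CStarSeminorm.bddAbove b) p)))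
    (fun c a => by simp only [map_smul_eq_mul]; exact (Real.mul_iSup_of_nonneg (norm_nonneg c) _).symm)

theorem le_maxSeminorm (p : Λ.CStarSeminorm) (a : FreeStarAlgebra (Mor V)) :
    p.toSeminorm a ≤ Λ.maxSeminorm a :=
  le_ciSup (CStarSeminorm.bddAbove a) p

theorem maxSeminorm_le {a : FreeStarAlgebra (Mor V)} {M : ℝ}
    (h : ∀ p : Λ.CStarSeminorm, p.toSeminorm a ≤ M) : Λ.maxSeminorm a ≤ M :=
  ciSup_le h

theorem maxSeminorm_mul_le (a b : FreeStarAlgebra (Mor V)) :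
    Λ.maxSeminorm (a * b) ≤ Λ.maxSeminorm a * Λ.maxSeminorm b :=
  Λ.maxSeminorm_le fun p => (p.mul_le a b).trans <|
    mul_le_mul (Λ.le_maxSeminorm p a) (Λ.le_maxSeminorm p b) (apply_nonneg _ _) (apply_nonneg _ _)

theorem maxSeminorm_star_mul_self (a : FreeStarAlgebra (Mor V)) :
    Λ.maxSeminorm (star a * a) = Λ.maxSeminorm a * Λ.maxSeminorm a := by
  apply le_antisymm
  · refine Λ.maxSeminorm_le fun p => ?_
    rw [p.star_mul_self]
    exact mul_le_mul (Λ.le_maxSeminorm p a) (Λ.le_maxSeminorm p a) (apply_nonneg _ _)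
      (apply_nonneg _ _)
  · have h : Λ.maxSeminorm a ≤ √(Λ.maxSeminorm (star a * a)) := Λ.maxSeminorm_le fun p =>
      Real.le_sqrt_of_sq_le (by rw [sq, ← p.star_mul_self]; exact Λ.le_maxSeminorm p _)
    calc _ ≤ √(Λ.maxSeminorm (star a * a)) * √(Λ.maxSeminorm (star a * a)) :=
          mul_self_le_mul_self (apply_nonneg _ _) h
      _ = _ := Real.mul_self_sqrt (apply_nonneg _ _)

/-- The free `*`-algebra on the paths of `Λ`, with the largest `C*`-seminorm in which the defining
relations hold. -/
def PreAlgebra (_ : OrdinalGraph.{w} V) : Type (max u v) := FreeStarAlgebra (Mor V)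

noncomputable instance : NonUnitalRing Λ.PreAlgebra :=
  inferInstanceAs (NonUnitalRing (FreeStarAlgebra (Mor V)))

noncomputable instance : StarRing Λ.PreAlgebra :=
  inferInstanceAs (StarRing (FreeStarAlgebra (Mor V)))

noncomputable instance : Module ℂ Λ.PreAlgebra :=
  inferInstanceAs (Module ℂ (FreeStarAlgebra (Mor V)))

noncomputable instance : PreCStarAlgebra Λ.PreAlgebra where
  __ := (inferInstance : NonUnitalRing Λ.PreAlgebra)
  __ := (inferInstance : StarRing Λ.PreAlgebra)
  __ := (inferInstance : Module ℂ Λ.PreAlgebra)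
  __ := AddGroupSeminorm.toSeminormedAddCommGroup Λ.maxSeminorm.toAddGroupSeminorm
  norm_mul_le := Λ.maxSeminorm_mul_le
  norm_smul_le c a := (map_smul_eq_mul Λ.maxSeminorm c a).le
  smul_assoc c a b := smul_mul_assoc (α := ℂ) (β := FreeStarAlgebra (Mor V)) c a b
  smul_comm c a b := (mul_smul_comm (α := ℂ) (β := FreeStarAlgebra (Mor V)) c a b).symm
  star_smul c a := star_smul (R := ℂ) (A := FreeStarAlgebra (Mor V)) c a
  norm_star_mul_self := Λ.maxSeminorm_star_mul_self

/-- The `C*`-algebra `O(Λ)` of an ordinal graph: the universal `C*`-algebra generated by elements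
`T e`, `e ∈ Λ`, subject to the relations above, constructed as the Hausdorff completion of the free
`*`-algebra on the paths of `Λ` in the largest `C*`-seminorm in which the relations hold. -/
abbrev UniversalAlgebra : Type (max u v) := Completion Λ.PreAlgebra

/-- The canonical map from the free `*`-algebra to `O(Λ)`. -/
noncomputable def toUniversalAlgebra : FreeStarAlgebra (Mor V) →⋆ₙₐ[ℂ] Λ.UniversalAlgebra where
  toFun a := ((show Λ.PreAlgebra from a : Λ.PreAlgebra) : Completion Λ.PreAlgebra)
  map_smul' c a := Completion.coe_smul c (show Λ.PreAlgebra from a)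
  map_zero' := Completion.coe_zero
  map_add' a b := Completion.coe_add (show Λ.PreAlgebra from a) (show Λ.PreAlgebra from b)
  map_mul' a b := PreCStarAlgebra.coe_mul (show Λ.PreAlgebra from a) (show Λ.PreAlgebra from b)
  map_star' a := PreCStarAlgebra.coe_star (show Λ.PreAlgebra from a)

/-- The generator `T e` of `O(Λ)`. -/
noncomputable def T (e : Mor V) : Λ.UniversalAlgebra := Λ.toUniversalAlgebra (FreeStarAlgebra.of e)

theorem norm_toUniversalAlgebra (a : FreeStarAlgebra (Mor V)) : ‖Λ.toUniversalAlgebra a‖ = Λ.maxSeminorm a :=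
  Completion.norm_coe (show Λ.PreAlgebra from a)

theorem denseRange_toUniversalAlgebra : DenseRange Λ.toUniversalAlgebra := Completion.denseRange_coe (α := Λ.PreAlgebra)

theorem toUniversalAlgebra_eq {a b : FreeStarAlgebra (Mor V)}
    (h : ∀ p : Λ.CStarSeminorm, p.toSeminorm (a - b) = 0) : Λ.toUniversalAlgebra a = Λ.toUniversalAlgebra b := by
  rw [← sub_eq_zero, ← map_sub, ← norm_eq_zero, norm_toUniversalAlgebra]
  exact le_antisymm (Λ.maxSeminorm_le fun p => (h p).le) (apply_nonneg _ _)

theorem toUniversalAlgebra_star (a : FreeStarAlgebra (Mor V)) :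
    Λ.toUniversalAlgebra (star a) = star (Λ.toUniversalAlgebra a) := Λ.toUniversalAlgebra.map_star' a

/-- The generators of `O(Λ)` satisfy the defining relations. -/
theorem isCuntzKrieger_T : Λ.IsCuntzKrieger Λ.T where
  star_mul_self e := by
    simpa [T, toUniversalAlgebra_star] using Λ.toUniversalAlgebra_eq fun p => p.relations.star_mul_self e
  mul_eq_comp e f h := by
    simpa [T] using Λ.toUniversalAlgebra_eq fun p => p.relations.mul_eq_comp e f h
  star_mul_eq_zero e f h := by
    simpa [T, toUniversalAlgebra_star] using Λ.toUniversalAlgebra_eq fun p => p.relations.star_mul_eq_zero e f h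
  eq_sum x α h := by
    simpa [T, toUniversalAlgebra_star] using Λ.toUniversalAlgebra_eq fun p => p.relations.eq_sum x α h

end OrdinalGraph

namespace FreeStarAlgebra

variable {X B : Type*} [NonUnitalRing B] [StarRing B]

/-- The value of a word, given the values of the generators. -/
def wordLift (S : X → B) : FreeSemigroup (X × Bool) →ₙ* B :=
  FreeSemigroup.lift fun x : X × Bool => if x.2 then star (S x.1) else S x.1

theorem wordLift_wordStar (S : X → B) (x : FreeSemigroup (X × Bool)) :
    wordLift S (wordStar x) = star (wordLift S x) := by
  induction x using FreeSemigroup.recOnMul with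
  | ih1 x => obtain ⟨x, _ | _⟩ := x <;> simp [wordStar_of, wordLift]
  | ih2 x y hx hy => rw [wordStar_mul, map_mul, map_mul, star_mul, hx, hy]

variable [Module ℂ B] [IsScalarTower ℂ B B] [SMulCommClass ℂ B B]

theorem liftMagma_single (S : X → B) (x : FreeSemigroup (X × Bool)) (c : ℂ) :
    MonoidAlgebra.liftMagma ℂ (wordLift S) (MonoidAlgebra.single x c) = c • wordLift S x := by
  simp [MonoidAlgebra.liftMagma_apply_apply]

variable [StarModule ℂ B]

/-- The `*`-homomorphism on the free `*`-algebra determined by the images of the generators. -/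
noncomputable def lift (S : X → B) : FreeStarAlgebra X →⋆ₙₐ[ℂ] B where
  toNonUnitalAlgHom := MonoidAlgebra.liftMagma ℂ (wordLift S)
  map_star' a := by
    change MonoidAlgebra.liftMagma ℂ (wordLift S) (starHom a) =
      star (MonoidAlgebra.liftMagma ℂ (wordLift S) a)
    induction a using MonoidAlgebra.induction_linear with
    | zero => simp
    | add a b ha hb => simp only [map_add, star_add, ha, hb]
    | single x c =>
      rw [starHom_single, liftMagma_single, liftMagma_single, star_smul, wordLift_wordStar]

theorem lift_star (S : X → B) (a : FreeStarAlgebra X) : lift S (star a) = star (lift S a) :=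
  (lift S).map_star' a

theorem lift_of (S : X → B) (x : X) : lift S (of x) = S x :=
  (liftMagma_single S _ _).trans (by simp [wordLift])

end FreeStarAlgebra

namespace OrdinalGraph

variable {V : Type u} [Category.{v} V] (Λ : OrdinalGraph.{w} V)

section lift

variable {B : Type*} [NonUnitalCStarAlgebra B] {S : Mor V → B}

theorem norm_lift_le (hS : Λ.IsCuntzKrieger S) (a : FreeStarAlgebra (Mor V)) :
    ‖FreeStarAlgebra.lift S a‖ ≤ Λ.maxSeminorm a := by
  let φ := FreeStarAlgebra.lift S
  exact Λ.le_maxSeminorm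
    { toSeminorm := Seminorm.of (fun a => ‖φ a‖) (fun a b => by rw [map_add]; exact norm_add_le _ _)
        (fun c a => by rw [map_smul, norm_smul])
      mul_le := fun a b => by
        change ‖φ (a * b)‖ ≤ ‖φ a‖ * ‖φ b‖
        rw [map_mul]; exact norm_mul_le _ _
      star_mul_self := fun a => by
        change ‖φ (star a * a)‖ = ‖φ a‖ * ‖φ a‖
        rw [map_mul, map_star]; exact CStarRing.norm_star_mul_self
      relations :=
        { star_mul_self := fun e => by
            change ‖φ _‖ = 0
            rw [norm_eq_zero, map_sub, sub_eq_zero]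
            simpa [φ, FreeStarAlgebra.lift_of, FreeStarAlgebra.lift_star] using hS.star_mul_self e
          mul_eq_comp := fun e f h => by
            change ‖φ _‖ = 0
            rw [norm_eq_zero, map_sub, sub_eq_zero]
            simpa [φ, FreeStarAlgebra.lift_of, FreeStarAlgebra.lift_star] using hS.mul_eq_comp e f h
          star_mul_eq_zero := fun e f h => by
            change ‖φ _‖ = 0
            rw [norm_eq_zero, map_sub, sub_eq_zero]
            simpa [φ, FreeStarAlgebra.lift_of, FreeStarAlgebra.lift_star] using hS.star_mul_eq_zero e f h
          eq_sum := fun x α h => by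
            change ‖φ _‖ = 0
            rw [norm_eq_zero, map_sub, sub_eq_zero]
            simpa [φ, FreeStarAlgebra.lift_of, FreeStarAlgebra.lift_star] using hS.eq_sum x α h } } a

/-- The universal property of `O(Λ)`: a family in a `C*`-algebra that satisfies the defining
relations is the image of the generators under a `*`-homomorphism. -/
theorem exists_lift (hS : Λ.IsCuntzKrieger S) :
    ∃ π : Λ.UniversalAlgebra →⋆ₙₐ[ℂ] B, ∀ e, π (Λ.T e) = S e := by
  let φ : Λ.PreAlgebra → B := FreeStarAlgebra.lift S
  have hadd : ∀ a b : Λ.PreAlgebra, φ (a + b) = φ a + φ b :=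
    fun a b => map_add (FreeStarAlgebra.lift S) a b
  have hφ : UniformContinuous φ := by
    refine (LipschitzWith.mk_one fun a b => ?_).uniformContinuous
    rw [dist_eq_norm, dist_eq_norm]
    have := Λ.norm_lift_le hS (a - b : Λ.PreAlgebra)
    rwa [show FreeStarAlgebra.lift S (a - b : Λ.PreAlgebra) = φ a - φ b from
      map_sub (FreeStarAlgebra.lift S) a b] at this
  have hc : ∀ a : Λ.PreAlgebra, Completion.extension φ (a : Completion Λ.PreAlgebra) = φ a :=
    Completion.extension_coe hφ
  have hcont : Continuous (Completion.extension φ) := Completion.continuous_extension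
  refine ⟨{ toFun := Completion.extension φ, map_smul' := ?_, map_zero' := ?_, map_add' := ?_,
            map_mul' := ?_, map_star' := ?_ }, fun e => ?_⟩
  · intro c a
    induction a using Completion.induction_on with
    | hp =>
      exact isClosed_eq (f := fun a => Completion.extension φ (c • a))
        (g := fun a => c • Completion.extension φ a) (hcont.comp (continuous_const_smul c))
        (hcont.const_smul c)
    | ih a =>
      rw [← Completion.coe_smul, hc, hc]
      exact map_smul (FreeStarAlgebra.lift S) c a
  · rw [← Completion.coe_zero, hc]
    exact map_zero (FreeStarAlgebra.lift S)
  · intro a b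
    induction a, b using Completion.induction_on₂ with
    | hp => exact isClosed_eq (by fun_prop) (by fun_prop)
    | ih a b => rw [← Completion.coe_add, hc, hc, hc, hadd]
  · intro a b
    induction a, b using Completion.induction_on₂ with
    | hp => exact isClosed_eq (by fun_prop) (by fun_prop)
    | ih a b =>
      rw [← PreCStarAlgebra.coe_mul, hc, hc, hc]
      exact map_mul (FreeStarAlgebra.lift S) a b
  · intro a
    induction a using Completion.induction_on with
    | hp => exact isClosed_eq (hcont.comp continuous_star) (continuous_star.comp hcont)
    | ih a =>
      rw [← PreCStarAlgebra.coe_star, hc, hc]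
      exact map_star (FreeStarAlgebra.lift S) a
  · exact (hc _).trans (FreeStarAlgebra.lift_of S e)

end lift

/-- The Hilbert space `ℓ²(∂Λ)`. -/
noncomputable abbrev BoundaryL2 := lp (fun _ : Λ.BoundaryPath => ℂ) 2

open Classical in
/-- The standard basis vector `ξ_f` of `ℓ²(∂Λ)`. -/
noncomputable def ξ (f : Λ.BoundaryPath) : Λ.BoundaryL2 := lp.single 2 f 1

end OrdinalGraph

/-! By the universal property `exists_lift` it suffices to produce a Cuntz-Krieger family on
`ℓ²(∂Λ)`. Prepending `e` is an injective partial map `shift e` of `∂Λ`, and a partial bijection `σ`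
of an index set induces a partial isometry `σ.toL2` of its `ℓ²`. Since products of such operators
come from composition and adjoints from inversion (`PEquiv.toL2_mul`, `PEquiv.star_toL2`), the first
three relations become statements about partial bijections. They follow from left cancellation,
associativity of concatenation, and the fact that two segments of one path are comparable.

Two points concern boundary paths proper. First, `∂Λ` is stable under prepending
(`IsBoundary.concat`): an `α`-regular vertex passed inside `e`, at distance less than `ω ^ α` from
the end of `e`, makes `s(e)` itself `α`-regular (`IsRegular.src`), so the condition on the tail
provides the required length. It is also stable under removing an initial segment
(`IsBoundary.of_concat`), so `S_e S_e^*` is the projection onto the boundary paths that begin with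
`e`. Second, if `x` is `α`-regular, every boundary path with range `x` is long enough to have a
segment of length `ω ^ α`, hence begins with exactly one `e ∈ x Λ^{ω^α}`; this is the summation
relation (`shiftOperator_vertex_eq_sum`). -/

namespace Mor

variable {V : Type u} [Category.{v} V]

/-! ### Prefixes, cancellation and paths of length zero. -/

theorem IsPrefix.refl (p : Mor V) : p.IsPrefix p := by
  refine ⟨vertex p.src, rfl, ?_⟩
  obtain ⟨p⟩ := p
  simp [comp, vertex]

theorem vertex_comp (x : V) (e : Mor V) (h : x = e.rng) : (vertex x).comp e h = e := by
  subst h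
  obtain ⟨e⟩ := e
  change (⟨e ≫ eqToHom rfl ≫ 𝟙 _⟩ : Mor V) = ⟨e⟩
  simp

theorem comp_congr {e f e' f' : Mor V} (he : e = e') (hf : f = f') (h : e.src = f.rng)
    (h' : e'.src = f'.rng) : e.comp f h = e'.comp f' h' := by
  subst he hf
  rfl

end Mor

namespace OrdinalGraph

variable {V : Type u} [Category.{v} V]

/-- Both composites factor the same path with first factor `e`; uniqueness of the factorization at
length `d(e)` determines the second factor as well. -/
theorem comp_left_cancel (Λ : OrdinalGraph.{w} V) {e f g : Mor V} {hf : e.src = f.rng} {hg : e.src = g.rng}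
    (h : e.comp f hf = e.comp g hg) : f = g := by
  obtain ⟨e⟩ := e
  obtain ⟨f⟩ := f
  obtain ⟨g⟩ := g
  dsimp only at hf hg
  subst hf hg
  simp only [Mor.comp, eqToHom_refl, Category.id_comp, Mor.mk.injEq] at h
  obtain ⟨rfl, -, h⟩ := h
  have := (Λ.factorization (f ≫ e) (Λ.d e) (by rw [Λ.d_comp]; exact le_self_add)).unique
    (y₁ := ⟨_, e, f⟩) (y₂ := ⟨_, e, g⟩) ⟨rfl, rfl⟩ ⟨rfl, eq_of_heq h⟩
  simp only [Sigma.mk.injEq, heq_eq_eq, Prod.mk.injEq, true_and] at this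
  rw [this]

variable (Λ : OrdinalGraph.{w} V)

theorem length_vertex (x : V) : Λ.length (Mor.vertex x) = 0 := Λ.d_id x

theorem eq_vertex_of_length_eq_zero {e : Mor V} (h : Λ.length e = 0) : e = Mor.vertex e.rng :=
  Λ.isPrefix_unique (Mor.IsPrefix.refl e) ⟨e, rfl, (Mor.vertex_comp _ e rfl).symm⟩
    (h.trans (Λ.length_vertex _).symm)

theorem src_eq_rng_of_length_eq_zero {e : Mor V} (h : Λ.length e = 0) : e.src = e.rng :=
  congrArg Mor.src (Λ.eq_vertex_of_length_eq_zero h)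

variable {Λ}

/-- Regularity passes from the range to the source of a path of length less than `ω ^ α`. -/
theorem IsRegular.src {e : Mor V} {α : Ordinal.{w}} (h : Λ.IsRegular e.rng α)
    (he : Λ.length e < Ordinal.omega0 ^ α) : Λ.IsRegular e.src α where
  sourceRegular f hf hl := by
    refine h.sourceRegular (e.comp f hf.symm) rfl ?_
    rw [Λ.length_comp]
    -- Ordinals below `ω ^ α` are closed under addition, so the extended path is still short enough
    -- to test source regularity at `r(e)`.
    exact Ordinal.isPrincipal_add_omega0_opow α he hl
  rowFinite := by
    have := h.rowFinite
    classical
    -- Prepending `e` embeds the paths of length `ω ^ α` into `s(e)` among those into `r(e)`,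
    -- because `d(e) + ω ^ α = ω ^ α`. The value in the `else` branch never matters on this set.
    let φ : Mor V → Mor V := fun f => if hf : e.src = f.rng then e.comp f hf else f
    refine Set.Finite.of_finite_image (f := φ) (this.subset ?_) ?_
    · rintro _ ⟨f, ⟨hf, hl⟩, rfl⟩
      simp only [φ, hf, dite_true]
      exact ⟨rfl, by rw [Λ.length_comp, hl, Ordinal.add_omega0_opow he]⟩
    · rintro f ⟨hf, -⟩ g ⟨hg, -⟩ hfg
      simp only [φ, hf, hg, dite_true] at hfg
      exact Λ.comp_left_cancel hfg

/-! ### Segments of transfinite paths. -/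

namespace TransfinitePath

theorem ext_seg {f g : Λ.TransfinitePath} (hL : f.L = g.L)
    (h : ∀ β (hf : β < f.L) (hg : β < g.L), f.seg β hf = g.seg β hg) : f = g := by
  obtain ⟨L, _, s, _, _⟩ := f
  obtain ⟨L', _, s', _, _⟩ := g
  dsimp only at hL
  subst hL
  have : s = s' := funext fun β => funext fun hβ => h β hβ hβ
  subst this
  rfl

theorem seg_congr (f : Λ.TransfinitePath) {β γ : Ordinal.{w}} (h : β = γ) (hβ : β < f.L)
    (hγ : γ < f.L) : f.seg β hβ = f.seg γ hγ := by
  subst h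
  rfl

theorem seg_congr_path {f g : Λ.TransfinitePath} (h : f = g) (β : Ordinal.{w}) (hf : β < f.L)
    (hg : β < g.L) : f.seg β hf = g.seg β hg := by
  subst h
  rfl

theorem src_seg_zero (f : Λ.TransfinitePath) : (f.seg 0 f.L_pos).src = f.rng :=
  Λ.src_eq_rng_of_length_eq_zero (f.length_seg _ _)

theorem eq_seg_of_isPrefix (f : Λ.TransfinitePath) {β : Ordinal.{w}} (h : β < f.L) {p : Mor V}
    (hp : p.IsPrefix (f.seg β h)) (h' : Λ.length p < f.L) : p = f.seg (Λ.length p) h' := by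
  have hle : Λ.length p ≤ β := by
    obtain ⟨g, hg, e⟩ := hp
    rw [← f.length_seg β h, e, Λ.length_comp]
    exact le_self_add
  exact Λ.isPrefix_unique hp (f.isPrefix_seg _ _ hle h) (f.length_seg _ _).symm

end TransfinitePath

/-! ### The calculus of concatenation. -/

variable (Λ)

theorem concat_L (e : Mor V) (f : Λ.TransfinitePath) (h : e.src = f.rng) :
    (Λ.concat e f h).L = Λ.length e + f.L := rfl

theorem concat_seg_add (e : Mor V) (f : Λ.TransfinitePath) (h : e.src = f.rng) (β : Ordinal.{w})
    (hβ : β < f.L) (hβ' : Λ.length e + β < (Λ.concat e f h).L) :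
    (Λ.concat e f h).seg (Λ.length e + β) hβ' =
      e.comp (f.seg β hβ) (h.trans (f.rng_seg _ _).symm) := by
  simp only [concat, le_add_iff_nonneg_right, zero_le, dite_true]
  exact Mor.comp_congr rfl (f.seg_congr (by simp) _ _) _ _

theorem length_lt_concat_L (e : Mor V) (f : Λ.TransfinitePath) (h : e.src = f.rng) :
    Λ.length e < (Λ.concat e f h).L := by
  rw [concat_L]
  exact lt_add_of_pos_right _ f.L_pos

theorem concat_seg_length (e : Mor V) (f : Λ.TransfinitePath) (h : e.src = f.rng) :
    (Λ.concat e f h).seg (Λ.length e) (Λ.length_lt_concat_L e f h) = e := by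
  refine (TransfinitePath.eq_seg_of_isPrefix _ (β := Λ.length e + 0)
    (by simpa using Λ.length_lt_concat_L e f h) ?_ _).symm
  rw [concat_seg_add _ _ _ _ _ f.L_pos]
  exact Mor.isPrefix_comp _ _ _

theorem concat_rng (e : Mor V) (f : Λ.TransfinitePath) (h : e.src = f.rng) :
    (Λ.concat e f h).rng = e.rng := by
  rw [← (Λ.concat e f h).rng_seg _ (Λ.length_lt_concat_L e f h), concat_seg_length]

/-- Segments shorter than `d(e)` need no check: they are prefixes of the segment at `d(e) + 0`,
hence determined by unique factorization. This keeps the `initial` branch of `concat` out of later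
arguments. -/
theorem eq_concat {e : Mor V} {f g : Λ.TransfinitePath} {h : e.src = g.rng}
    (hL : f.L = Λ.length e + g.L)
    (hs : ∀ β (hβ : β < g.L) (hβ' : Λ.length e + β < f.L),
      f.seg (Λ.length e + β) hβ' = e.comp (g.seg β hβ) (h.trans (g.rng_seg _ _).symm)) :
    f = Λ.concat e g h := by
  have key : ∀ β (hf : Λ.length e + β < f.L) (hg : Λ.length e + β < (Λ.concat e g h).L),
      f.seg _ hf = (Λ.concat e g h).seg _ hg := fun β hf hg => by
    have hβ : β < g.L := by simpa [hL] using hf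
    rw [hs β hβ, concat_seg_add]
  refine TransfinitePath.ext_seg hL fun β hf hg => ?_
  rcases le_total (Λ.length e) β with hβ | hβ
  · have e1 := Ordinal.add_sub_cancel_of_le hβ
    rw [f.seg_congr e1.symm hf (e1.symm ▸ hf), TransfinitePath.seg_congr _ e1.symm hg (e1.symm ▸ hg)]
    exact key _ _ _
  · have h0 : Λ.length e + 0 < f.L := by
      rw [hL]; exact add_lt_add_right g.L_pos _
    refine Λ.isPrefix_unique (f.isPrefix_seg β (Λ.length e + 0) (by simpa using hβ) h0) ?_
      ((f.length_seg _ _).trans (TransfinitePath.length_seg _ _ _).symm)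
    rw [key 0 h0 (by rwa [hL] at h0)]
    exact TransfinitePath.isPrefix_seg _ β (Λ.length e + 0) (by simpa using hβ) _

theorem concat_vertex (f : Λ.TransfinitePath) (x : V) (h : x = f.rng) :
    Λ.concat (Mor.vertex x) f h = f := by
  refine (Λ.eq_concat (by simp [length_vertex]) fun β hβ hβ' => ?_).symm
  exact (f.seg_congr (by simp [length_vertex]) _ _).trans (Mor.vertex_comp _ _ _).symm

theorem concat_concat (e e' : Mor V) (f : Λ.TransfinitePath) (h : e.src = e'.rng)
    (h' : e'.src = f.rng) (h'' : e.src = (Λ.concat e' f h').rng) :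
    Λ.concat e (Λ.concat e' f h') h'' = Λ.concat (e.comp e' h) f h' := by
  refine Λ.eq_concat (by simp only [concat_L, length_comp, add_assoc]) fun β hβ hβ' => ?_
  have e1 : Λ.length (e.comp e' h) + β = Λ.length e + (Λ.length e' + β) := by
    rw [length_comp, add_assoc]
  have hl : Λ.length e' + β < (Λ.concat e' f h').L := by
    rw [concat_L]; exact add_lt_add_right hβ _
  rw [TransfinitePath.seg_congr _ e1 hβ' (e1 ▸ hβ'), Λ.concat_seg_add _ _ _ _ hl]
  refine Eq.trans (Mor.comp_congr rfl (Λ.concat_seg_add _ _ _ _ hβ hl) _ ?_)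
    (Mor.comp_assoc _ _ _ h _).symm
  exact h

/-- Left cancellation for ordinal addition matches the lengths, and `comp_left_cancel` the segments.
This injectivity is what makes `shift` a partial bijection. -/
theorem concat_left_cancel {e : Mor V} {f g : Λ.TransfinitePath} {hf : e.src = f.rng}
    {hg : e.src = g.rng} (h : Λ.concat e f hf = Λ.concat e g hg) : f = g := by
  have hL : f.L = g.L := by
    have := congrArg TransfinitePath.L h
    simpa only [concat_L, add_right_inj] using this
  refine TransfinitePath.ext_seg hL fun β hβ hβ' => Λ.comp_left_cancel (e := e)
    (hf := hf.trans (f.rng_seg _ _).symm) (hg := hg.trans (g.rng_seg _ _).symm) ?_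
  have hl : Λ.length e + β < (Λ.concat e f hf).L := by
    rw [concat_L]; exact add_lt_add_right hβ _
  rw [← Λ.concat_seg_add e f hf β hβ hl, ← Λ.concat_seg_add e g hg β hβ' (h ▸ hl)]
  exact TransfinitePath.seg_congr_path h _ _ _

/-! ### Removing initial segments, and stability of the boundary. -/

variable {Λ}

/-- Every `f ∈ Λ^*` factors through each of its segments. -/
theorem TransfinitePath.exists_eq_concat (f : Λ.TransfinitePath) {δ : Ordinal.{w}} (hδ : δ < f.L) :
    ∃ (g : Λ.TransfinitePath) (h : (f.seg δ hδ).src = g.rng), f = Λ.concat (f.seg δ hδ) g h := by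
  have hlt : ∀ {β}, β < f.L - δ → δ + β < f.L := fun h => Ordinal.lt_sub.1 h
  have hpre := fun β (hβ : β < f.L - δ) => f.isPrefix_seg δ (δ + β) le_self_add (hlt hβ)
  -- The tail consists of the remainders in `f(δ + β) = f(δ) t(β)`.
  choose t ht hst using hpre
  have hlen : ∀ β hβ, Λ.length (t β hβ) = β := fun β hβ => by
    have := f.length_seg (δ + β) (hlt hβ)
    rw [hst β hβ, Λ.length_comp, f.length_seg] at this
    exact add_left_cancel this
  have hpos : 0 < f.L - δ := by simpa [Ordinal.lt_sub] using hδ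
  let g : Λ.TransfinitePath :=
    { L := f.L - δ
      L_pos := hpos
      seg := t
      length_seg := hlen
      isPrefix_seg := fun γ β hγβ hβ => by
        obtain ⟨k, hk, hs⟩ := f.isPrefix_seg (δ + γ) (δ + β) (by gcongr) (hlt hβ)
        have hγ := hγβ.trans_lt hβ
        have hk' : (t γ hγ).src = k.rng := by
          rw [← hk, hst γ hγ]; rfl
        refine ⟨k, hk', Λ.comp_left_cancel (e := f.seg δ hδ) (hf := ht β hβ)
          (hg := ht γ hγ) ?_⟩
        -- Coherence of the remainders, after cancelling `f(δ)`: `f(δ) t(β) = f(δ + β) = f(δ + γ) k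
        -- = f(δ) t(γ) k`.
        rw [← hst β hβ, hs, ← Mor.comp_assoc _ _ _ (ht γ hγ) hk']
        exact Mor.comp_congr (hst γ hγ) rfl _ _ }
  have hl : Λ.length (f.seg δ hδ) = δ := f.length_seg _ _
  refine ⟨g, ht 0 hpos, Λ.eq_concat ?_ fun β hβ hβ' => ?_⟩
  · rw [hl, Ordinal.add_sub_cancel_of_le hδ.le]
  · rw [f.seg_congr (congrArg (· + β) hl) hβ' (hlt hβ), hst]

/-- A regular vertex at a position `γ ≥ d(e)` lies on `f`, and the condition for `f` is translated
by `d(e)`. If `γ + ω ^ α ≤ d(e)`, then `e` alone is long enough. In the remaining case regularity is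
carried along the rest of `e` to `s(e) = r(f)`. -/
theorem IsBoundary.concat {e : Mor V} {f : Λ.TransfinitePath}
    (hf : Λ.IsBoundary f) (h : e.src = f.rng) : Λ.IsBoundary (Λ.concat e f h) := by
  intro γ hγ α hr
  rw [concat_L]
  rcases le_total (Λ.length e) γ with hle | hle
  · obtain ⟨β, rfl⟩ : ∃ β, γ = Λ.length e + β := ⟨_, (Ordinal.add_sub_cancel_of_le hle).symm⟩
    have hβ : β < f.L := by simpa [concat_L] using hγ
    rw [Λ.concat_seg_add _ _ _ _ hβ] at hr
    rw [add_assoc]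
    exact add_lt_add_right (hf β hβ α hr) _
  · by_cases hlt : γ + Ordinal.omega0 ^ α ≤ Λ.length e
    · exact hlt.trans_lt (lt_add_of_pos_right _ f.L_pos)
    -- Write `e = e(γ) g`. As `γ + d(g) = d(e) < γ + ω ^ α`, the path `g` is shorter than `ω ^ α`,
    -- so `IsRegular.src` applies to it.
    · obtain ⟨g, hg, hs⟩ := (Λ.concat e f h).isPrefix_seg γ _ hle (Λ.length_lt_concat_L e f h)
      rw [concat_seg_length] at hs
      have hlen := congrArg Λ.length hs
      rw [Λ.length_comp, TransfinitePath.length_seg] at hlen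
      have hreg : Λ.IsRegular (f.seg 0 f.L_pos).src α := by
        rw [f.src_seg_zero, ← h, hs]
        refine IsRegular.src (e := g) (hg ▸ hr) ?_
        rw [not_le, hlen] at hlt
        exact lt_of_add_lt_add_left hlt
      have := hf 0 f.L_pos α hreg
      rw [zero_add] at this
      calc γ + Ordinal.omega0 ^ α ≤ Λ.length e + Ordinal.omega0 ^ α := by gcongr
        _ < _ := add_lt_add_right this _

/-- The vertex of `f` at `γ` is the vertex of `ef` at `d(e) + γ`, and `d(e)` cancels on the left of
the resulting inequality. -/
theorem IsBoundary.of_concat {e : Mor V} {f : Λ.TransfinitePath}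
    {h : e.src = f.rng} (hf : Λ.IsBoundary (Λ.concat e f h)) : Λ.IsBoundary f := by
  intro γ hγ α hr
  have hl : Λ.length e + γ < (Λ.concat e f h).L := by
    rw [concat_L]; exact add_lt_add_right hγ _
  have := hf _ hl α (by rwa [Λ.concat_seg_add _ _ _ _ hγ])
  rw [concat_L, add_assoc] at this
  exact lt_of_add_lt_add_left this

end OrdinalGraph

/-! ### Partial isometries of `ℓ²` from partial bijections. -/

section PEquiv

variable {ι : Type*}

/-- The vector with entry `x i` at `σ i`, and `0` outside the range of `σ`. -/
def PEquiv.pushforward (σ : ι ≃. ι) (x : ι → ℂ) (j : ι) : ℂ := (σ.symm j).elim 0 x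

/-- The nonzero terms on the left are matched by `σ.symm` with the nonzero terms of `x` over the
finite set of preimages of `s`. Thus every finite partial sum is at most `‖x‖ ^ 2`, which gives both
membership in `ℓ²` and contractivity. -/
theorem PEquiv.sum_pushforward_le (σ : ι ≃. ι) (x : lp (fun _ : ι => ℂ) 2) (s : Finset ι) :
    ∑ j ∈ s, ‖σ.pushforward x j‖ ^ (2 : ENNReal).toReal ≤ ‖x‖ ^ (2 : ENNReal).toReal := by
  refine le_trans (le_of_eq ?_) (lp.sum_rpow_le_norm_rpow (by norm_num) x
    (s.filterMap σ.symm fun _ _ _ h h' => σ.symm.inj h h'))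
  have hs : ∀ j, ‖σ.pushforward x j‖ ^ (2 : ENNReal).toReal ≠ 0 → (σ.symm j).isSome := by
    intro j h
    by_contra h'
    rw [Option.not_isSome_iff_eq_none] at h'
    simp [PEquiv.pushforward, h'] at h
  refine Finset.sum_bij_ne_zero (fun j _ h => (σ.symm j).get (hs j h)) ?_ ?_ ?_ ?_
  · intro j hj h
    exact (Finset.mem_filterMap _).2 ⟨j, hj, (Option.some_get _).symm⟩
  · intro j _ h k _ h' hjk
    refine σ.symm.inj (b := (σ.symm j).get (hs j h)) ?_ ?_
    · exact Option.get_mem _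
    · rw [hjk]; exact Option.get_mem _
  · intro i hi h
    obtain ⟨j, hj, hji⟩ := (Finset.mem_filterMap _).1 hi
    refine ⟨j, hj, ?_, ?_⟩
    · simpa [PEquiv.pushforward, hji] using h
    · simp [hji]
  · intro j _ h
    obtain ⟨i, hi⟩ := Option.isSome_iff_exists.1 (hs j h)
    simp [PEquiv.pushforward, hi]

/-- The partial isometry on `ℓ²(ι)` that maps the basis vector at `i` to the one at `σ i`, or to
zero if `σ` is not defined at `i`. -/
noncomputable def PEquiv.toL2 (σ : ι ≃. ι) :
    lp (fun _ : ι => ℂ) 2 →L[ℂ] lp (fun _ : ι => ℂ) 2 :=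
  LinearMap.mkContinuous
    { toFun := fun x => ⟨σ.pushforward x, memℓp_gen' (σ.sum_pushforward_le x)⟩
      map_add' := fun x y => lp.ext <| funext fun j => by
        change σ.pushforward _ j = σ.pushforward x j + σ.pushforward y j
        unfold PEquiv.pushforward
        cases σ.symm j with
        | none => exact (add_zero 0).symm
        | some i => rfl
      map_smul' := fun c x => lp.ext <| funext fun j => by
        change σ.pushforward _ j = c • σ.pushforward x j
        unfold PEquiv.pushforward
        cases σ.symm j with
        | none => exact (smul_zero c).symm
        | some i => rfl } 1
    fun x => by
      rw [one_mul]
      exact lp.norm_le_of_forall_sum_le (by norm_num) (norm_nonneg x) (σ.sum_pushforward_le x)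

theorem PEquiv.toL2_apply (σ : ι ≃. ι) (x : lp (fun _ : ι => ℂ) 2) (j : ι) :
    σ.toL2 x j = (σ.symm j).elim 0 x := rfl

/-- The order is reversed because `trans` applies its left argument first, whereas a product of
operators applies its right factor first. -/
theorem PEquiv.toL2_mul (σ τ : ι ≃. ι) : σ.toL2 * τ.toL2 = (τ.trans σ).toL2 := by
  ext x j
  change σ.toL2 (τ.toL2 x) j = _
  rw [PEquiv.toL2_apply, PEquiv.toL2_apply, PEquiv.symm_trans_rev]
  change _ = ((σ.symm j).bind τ.symm).elim 0 x
  cases σ.symm j <;> rfl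

theorem PEquiv.toL2_bot : (⊥ : ι ≃. ι).toL2 = 0 := rfl

open Classical in
theorem PEquiv.toL2_single (σ : ι ≃. ι) (i : ι) :
    σ.toL2 (lp.single 2 i 1) = (σ i).elim 0 fun j => lp.single 2 j 1 := by
  ext k
  rw [PEquiv.toL2_apply]
  cases h : σ.symm k with
  | none =>
    cases h' : σ i with
    | none => simp
    | some j =>
      have : k ≠ j := by
        rintro rfl
        rw [← σ.eq_some_iff, h] at h'
        cases h'
      simp [lp.single_apply, this]
  | some l =>
    have hl := σ.eq_some_iff.1 h
    cases h' : σ i with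
    | none =>
      have : l ≠ i := by rintro rfl; rw [h'] at hl; cases hl
      simp [lp.single_apply, this]
    | some j =>
      by_cases hli : l = i
      · subst hli
        obtain rfl : j = k := by simpa [h'] using hl
        simp
      · have : k ≠ j := by
          rintro rfl
          exact hli (σ.inj hl h')
        simp [lp.single_apply, hli, this]

/-- Pairing with the basis vector at `i` reads off the entry of the adjoint: `⟨ξ_i, σ^* x⟩ = ⟨σ ξ_i,
x⟩`, which is `x (σ i)`, or `0` where `σ` is undefined. -/
theorem PEquiv.star_toL2 (σ : ι ≃. ι) : star σ.toL2 = σ.symm.toL2 := by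
  classical
  ext x i
  have h := ContinuousLinearMap.adjoint_inner_right σ.toL2 (lp.single 2 i 1) x
  rw [lp.inner_single_left, PEquiv.toL2_single] at h
  rw [PEquiv.toL2_apply, PEquiv.symm_symm, ContinuousLinearMap.star_eq_adjoint]
  cases h' : σ i with
  | none => simpa [h'] using h
  | some j => simpa [h', lp.inner_single_left] using h

end PEquiv

/-! ### Prepending as a partial bijection of the boundary. -/

namespace OrdinalGraph

variable {V : Type u} [Category.{v} V] (Λ : OrdinalGraph.{w} V)

variable {Λ}

/-- The element of `Λ^*` underlying a boundary path. -/
def BoundaryPath.path (f : Λ.BoundaryPath) : Λ.TransfinitePath := f.1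

theorem BoundaryPath.isBoundary_path (f : Λ.BoundaryPath) : Λ.IsBoundary f.path := f.2

theorem BoundaryPath.ext_path {f g : Λ.BoundaryPath} (h : f.path = g.path) : f = g := Subtype.ext h

/-- The boundary path `e f`. -/
noncomputable def BoundaryPath.prepend (e : Mor V) (f : Λ.BoundaryPath) (h : e.src = f.path.rng) :
    Λ.BoundaryPath := ⟨Λ.concat e f.path h, f.isBoundary_path.concat h⟩

variable (Λ)

open Classical in
/-- The partial bijection `f ↦ e f` of `∂Λ`. -/
noncomputable def shift (e : Mor V) : Λ.BoundaryPath ≃. Λ.BoundaryPath where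
  toFun f := if h : e.src = f.path.rng then some (f.prepend e h) else none
  invFun g := if h : ∃ f : Λ.BoundaryPath, ∃ h : e.src = f.path.rng, f.prepend e h = g then
    some h.choose else none
  inv f g := by
    constructor
    · intro h
      split_ifs at h with hg
      · obtain ⟨hf, hc⟩ := hg.choose_spec
        obtain rfl : hg.choose = f := by simpa using h
        rw [dif_pos hf]
        exact congrArg some hc
    · intro h
      split_ifs at h with hf
      · have hc : f.prepend e hf = g := Option.some.inj h
        have hg : ∃ f : Λ.BoundaryPath, ∃ h : e.src = f.path.rng, f.prepend e h = g := ⟨f, hf, hc⟩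
        rw [dif_pos hg]
        obtain ⟨hf', hc'⟩ := hg.choose_spec
        -- The chosen preimage is the given one, since concatenation with `e` is injective.
        exact congrArg some (BoundaryPath.ext_path
          (Λ.concat_left_cancel (hf := hf') (hg := hf) (congrArg BoundaryPath.path (hc'.trans hc.symm))))

theorem shift_of_eq (e : Mor V) (f : Λ.BoundaryPath) (h : e.src = f.path.rng) :
    Λ.shift e f = some (f.prepend e h) := dif_pos h

theorem shift_of_ne (e : Mor V) (f : Λ.BoundaryPath) (h : e.src ≠ f.path.rng) :
    Λ.shift e f = none := dif_neg h

theorem shift_eq_some_iff {e : Mor V} {f g : Λ.BoundaryPath} :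
    Λ.shift e f = some g ↔ ∃ h : e.src = f.path.rng, Λ.concat e f.path h = g.path := by
  by_cases h : e.src = f.path.rng
  · rw [Λ.shift_of_eq e f h, Option.some.injEq]
    exact ⟨fun h' => ⟨h, congrArg BoundaryPath.path h'⟩,
      fun ⟨_, h'⟩ => BoundaryPath.ext_path h'⟩
  · rw [Λ.shift_of_ne e f h]
    simp [h]

theorem shift_vertex_eq_some_iff {x : V} {f g : Λ.BoundaryPath} :
    Λ.shift (Mor.vertex x) f = some g ↔ x = f.path.rng ∧ f = g := by
  rw [shift_eq_some_iff]
  constructor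
  · rintro ⟨h, h'⟩
    exact ⟨h, BoundaryPath.ext_path ((Λ.concat_vertex _ _ h).symm.trans h')⟩
  · rintro ⟨h, rfl⟩
    exact ⟨h, Λ.concat_vertex _ _ h⟩

theorem shift_trans_symm (e : Mor V) :
    (Λ.shift e).trans (Λ.shift e).symm = Λ.shift (Mor.vertex e.src) := by
  ext f g
  simp only [PEquiv.trans_eq_some, PEquiv.eq_some_iff, shift_vertex_eq_some_iff]
  constructor
  · rintro ⟨k, hf, hg⟩
    exact ⟨(Λ.shift_eq_some_iff.1 hf).1, (Λ.shift e).inj hf hg⟩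
  · rintro ⟨h, rfl⟩
    exact ⟨_, Λ.shift_of_eq e f h, Λ.shift_of_eq e f h⟩

theorem shift_trans_shift (e f : Mor V) (h : e.src = f.rng) :
    (Λ.shift f).trans (Λ.shift e) = Λ.shift (e.comp f h) := by
  ext g k
  simp only [PEquiv.trans_eq_some, shift_eq_some_iff]
  constructor
  · rintro ⟨a, ⟨hf, ha⟩, he, hk⟩
    obtain rfl : g.prepend f hf = a := BoundaryPath.ext_path ha
    exact ⟨hf, (Λ.concat_concat e f _ h hf he).symm.trans hk⟩
  · rintro ⟨hf, hk⟩
    have hf' : f.src = g.path.rng := hf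
    exact ⟨g.prepend f hf', ⟨hf', rfl⟩, h.trans (Λ.concat_rng f g.path hf').symm,
      (Λ.concat_concat e f g.path h hf' _).trans hk⟩

/-- A boundary path in both ranges has `e` and `f` among its segments; its segment of length `max (d
e) (d f)` would then be a common extension. -/
theorem shift_trans_symm_eq_bot {e f : Mor V} (h : ¬ ∃ g, e.IsPrefix g ∧ f.IsPrefix g) :
    (Λ.shift f).trans (Λ.shift e).symm = ⊥ := by
  ext g k
  simp only [PEquiv.trans_eq_some, PEquiv.eq_some_iff, shift_eq_some_iff]
  constructor
  · rintro ⟨a, ⟨hf, ha⟩, he, ha'⟩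
    refine absurd ?_ h
    have key : ∀ (e : Mor V) (g : Λ.BoundaryPath) (he : e.src = g.path.rng),
        Λ.concat e g.path he = a.path → ∃ hl : Λ.length e < a.path.L, a.path.seg _ hl = e := by
      intro e g he ha
      rw [← ha]
      exact ⟨Λ.length_lt_concat_L _ _ _, Λ.concat_seg_length _ _ _⟩
    obtain ⟨lf, hf⟩ := key f g hf ha
    obtain ⟨le, he⟩ := key e k he ha'
    refine ⟨a.path.seg (max (Λ.length e) (Λ.length f)) (max_lt le lf), ?_, ?_⟩
    · have := a.path.isPrefix_seg _ _ (le_max_left (Λ.length e) (Λ.length f)) (max_lt le lf)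
      rwa [he] at this
    · have := a.path.isPrefix_seg _ _ (le_max_right (Λ.length e) (Λ.length f)) (max_lt le lf)
      rwa [hf] at this
  · intro h'
    cases h'

/-! ### The Cuntz-Krieger family on the boundary. -/

/-- The operator `ξ_f ↦ ξ_{ef}` on `ℓ²(∂Λ)`. -/
noncomputable def shiftOperator (e : Mor V) : Λ.BoundaryL2 →L[ℂ] Λ.BoundaryL2 := (Λ.shift e).toL2

/-- The range of `shift e` is the set of boundary paths whose segment at `d(e)` is `e`: such a path
factors through `e`, and its tail is again a boundary path. -/
theorem shiftOperator_mul_star_apply (e : Mor V) (x : Λ.BoundaryL2) (f : Λ.BoundaryPath)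
    [Decidable (∃ h : Λ.length e < f.path.L, f.path.seg _ h = e)] :
    (Λ.shiftOperator e * star (Λ.shiftOperator e)) x f =
      if ∃ h : Λ.length e < f.path.L, f.path.seg _ h = e then x f else 0 := by
  rw [shiftOperator, PEquiv.star_toL2, PEquiv.toL2_mul, PEquiv.toL2_apply, PEquiv.symm_trans_rev,
    PEquiv.symm_symm]
  change (((Λ.shift e).symm f).bind (Λ.shift e)).elim 0 x = _
  split_ifs with h
  · obtain ⟨hl, hs⟩ := h
    obtain ⟨g, hg, hf⟩ := f.path.exists_eq_concat hl
    have hb : Λ.IsBoundary g := IsBoundary.of_concat (hf ▸ f.isBoundary_path)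
    obtain ⟨g, rfl⟩ : ∃ k : Λ.BoundaryPath, k.path = g := ⟨⟨g, hb⟩, rfl⟩
    have : Λ.shift e g = some f := by
      rw [shift_eq_some_iff]
      refine ⟨hs ▸ hg, ?_⟩
      simp only [hs] at hf
      exact hf.symm
    rw [(Λ.shift e).eq_some_iff.2 this]
    rw [Option.bind_some, this, Option.elim_some]
  · cases h' : (Λ.shift e).symm f with
    | none => rfl
    | some g =>
      obtain ⟨hg, hf⟩ := Λ.shift_eq_some_iff.1 ((Λ.shift e).eq_some_iff.1 h')
      refine absurd ?_ h
      rw [← hf]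
      exact ⟨Λ.length_lt_concat_L _ _ _, Λ.concat_seg_length _ _ _⟩

theorem shiftOperator_vertex_apply (x : V) (a : Λ.BoundaryL2) (f : Λ.BoundaryPath)
    [Decidable (x = f.path.rng)] :
    Λ.shiftOperator (Mor.vertex x) a f = if x = f.path.rng then a f else 0 := by
  rw [shiftOperator, PEquiv.toL2_apply]
  split_ifs with h
  · rw [(Λ.shift _).eq_some_iff.2 (Λ.shift_vertex_eq_some_iff.2 ⟨h, rfl⟩)]
    rfl
  · cases h' : (Λ.shift (Mor.vertex x)).symm f with
    | none => rfl
    | some g =>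
      obtain ⟨hg, rfl⟩ := Λ.shift_vertex_eq_some_iff.1 ((Λ.shift _).eq_some_iff.1 h')
      exact absurd hg h

/-- Evaluated at a boundary path with range `x`, exactly one summand is nonzero, that of its segment
of length `ω ^ α`. At any other boundary path all summands vanish, since a segment has the same
range as the path. -/
theorem shiftOperator_vertex_eq_sum (x : V) (α : Ordinal.{w}) (h : Λ.IsRegular x α) :
    Λ.shiftOperator (Mor.vertex x) =
      ∑ e ∈ h.rowFinite.toFinset, Λ.shiftOperator e * star (Λ.shiftOperator e) := by
  classical
  ext a f
  rw [shiftOperator_vertex_apply, sum_apply, lp.coeFn_sum, Finset.sum_apply]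
  simp only [shiftOperator_mul_star_apply]
  split_ifs with hx
  -- The segment exists by the boundary condition at position `0`, where the vertex is `r(f) = x`.
  · have hl : Ordinal.omega0 ^ α < f.path.L := by
      have := f.isBoundary_path 0 f.path.L_pos α (by rwa [f.path.src_seg_zero, ← hx])
      rwa [zero_add] at this
    have hlen : Λ.length (f.path.seg _ hl) = Ordinal.omega0 ^ α := f.path.length_seg _ _
    rw [Finset.sum_eq_single (f.path.seg _ hl), if_pos]
    · exact ⟨hlen.symm ▸ hl, f.path.seg_congr hlen _ hl⟩
    · intro e he hne
      rw [if_neg]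
      rintro ⟨hl', hs⟩
      have he' : Λ.length e = _ := ((Set.Finite.mem_toFinset _).1 he).2
      exact hne (hs.symm.trans (f.path.seg_congr he' _ _))
    · intro hn
      refine absurd ((Set.Finite.mem_toFinset h.rowFinite).2 ?_) hn
      exact ⟨(f.path.rng_seg _ _).trans hx.symm, hlen⟩
  · refine (Finset.sum_eq_zero fun e he => ?_).symm
    have he' : e.rng = x := ((Set.Finite.mem_toFinset _).1 he).1
    rw [if_neg]
    rintro ⟨hl, hs⟩
    apply hx
    rw [← he', ← f.path.rng_seg _ hl, hs]

theorem isCuntzKrieger_shiftOperator : Λ.IsCuntzKrieger Λ.shiftOperator where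
  star_mul_self e := by
    rw [shiftOperator, PEquiv.star_toL2, PEquiv.toL2_mul, shift_trans_symm, shiftOperator]
  mul_eq_comp e f h := by
    rw [shiftOperator, shiftOperator, PEquiv.toL2_mul, Λ.shift_trans_shift e f h, shiftOperator]
  star_mul_eq_zero e f h := by
    rw [shiftOperator, shiftOperator, PEquiv.star_toL2, PEquiv.toL2_mul,
      Λ.shift_trans_symm_eq_bot h, PEquiv.toL2_bot]
  eq_sum := Λ.shiftOperator_vertex_eq_sum

theorem shiftOperator_ξ (e : Mor V) (f : Λ.BoundaryPath) :
    Λ.shiftOperator e (Λ.ξ f) = (Λ.shift e f).elim 0 Λ.ξ :=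
  (Λ.shift e).toL2_single f

end OrdinalGraph

theorem mainTheorem8 {V : Type u} [Category.{v} V] (Λ : OrdinalGraph.{w} V) :
    ∃ τ : Λ.UniversalAlgebra →⋆ₙₐ[ℂ] (Λ.BoundaryL2 →L[ℂ] Λ.BoundaryL2),
      ∀ (e : Mor V) (f : Λ.BoundaryPath),
        (∀ h : e.src = f.1.rng, ∃ hb : Λ.IsBoundary (Λ.concat e f.1 h),
          τ (Λ.T e) (Λ.ξ f) = Λ.ξ ⟨Λ.concat e f.1 h, hb⟩) ∧
        (e.src ≠ f.1.rng → τ (Λ.T e) (Λ.ξ f) = 0) := by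
  obtain ⟨τ, hτ⟩ := Λ.exists_lift Λ.isCuntzKrieger_shiftOperator
  refine ⟨τ, fun e f => ⟨fun h => ⟨f.2.concat h, ?_⟩, fun h => ?_⟩⟩
  · rw [hτ, Λ.shiftOperator_ξ, Λ.shift_of_eq e f h]
    rfl
  · rw [hτ, Λ.shiftOperator_ξ, Λ.shift_of_ne e f h]
    rfl
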